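/- Let $p$ be an odd prime, let $q=p^{2n}$ with $n\ge 1$ be an even power of $p$ (so $\sqrt q=p^n$), and let $\mathbb{F}_q$ be the finite field with $q$ elements. For $x\in\mathbb{F}_p$ put $e_p(x)=\exp(2\pi i x/p)$, and let $\operatorname{Tr}:\mathbb{F}_q\to\mathbb{F}_p$ be the absolute trace. For $A\subset\mathbb{F}_q$ and $c\in\mathbb{F}_q^*$ put $$S(q,A;c)=\sum_{a\in A}e_p\big(\operatorname{Tr}(ac)\big).$$ For a multiplicative character $\chi:\mathbb{F}_q^*\to\mathbb{C}^*$, extended by $\chi(0)=0$, let $$\epsilon(\chi)=q^{-1/2}\sum_{c\in\mathbb{F}_q}\chi(c)\,e_p\big(\operatorname{Tr}(c)\big)$$ be its normalized Gauss sum. Let $d>1$ be an integer dividing $\sqrt q+1$, and let $\chi$ be a multiplicative character of $\mathbb{F}_q$ of order $d$. Let $A\subset\mathbb{F}_q$ be a set with $0,1\in A$ and $|A|=\sqrt q$. If $S(q,A;c)=0$ for every $c\in\mathbb{F}_q^*$ with $\chi(c)\neq\epsilon(\chi)$, then $A=\mathbb{F}_{\sqrt q}$, the subfield of $\mathbb{F}_q$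 with $\sqrt q$ elements. -/

import Mathlib

/-- The canonical additive character `ψ₁(c) = e_p(Tr(c)) = exp(2πi Tr(c) / p)` of a finite field `F`
of characteristic `p`, where `Tr` is the absolute trace from `F` to the prime field `ZMod p`.
(`ZMod.stdAddChar` is the additive character `j ↦ exp(2πi j / p)` of `ZMod p`.) -/
noncomputable def canonicalAddChar (p : ℕ) [Fact p.Prime] (F : Type*) [Field F]
    [Algebra (ZMod p) F] : AddChar F ℂ :=
  (ZMod.stdAddChar (N := p)).compAddMonoidHom (Algebra.trace (ZMod p) F).toAddMonoidHom

/-- The exponential sum `S(q, A; c) = ∑_{a ∈ A} e_p(Tr(a c))`. -/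
noncomputable def expSum (p : ℕ) [Fact p.Prime] {F : Type*} [Field F]
    [Algebra (ZMod p) F] (A : Finset F) (c : F) : ℂ :=
  ∑ a ∈ A, canonicalAddChar p F (a * c)

/-- The normalized Gauss sum `ε(χ) = q^(-1/2) G(χ)`, where
`G(χ) = ∑_{c ∈ F} χ(c) ψ₁(c)` and `q` is the order of `F`. -/
noncomputable def normalizedGaussSum (p : ℕ) [Fact p.Prime] {F : Type*} [Field F] [Fintype F]
    [Algebra (ZMod p) F] (χ : MulChar F ℂ) : ℂ :=
  ((Real.sqrt (Fintype.card F : ℝ) : ℝ) : ℂ)⁻¹ * gaussSum χ (canonicalAddChar p F)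

/-! ### Character sums: differences of elements of `A` lie in the kernel of `χ`. -/

section CharacterSums

/-! Write `Q = √q` and `S(c)` for the exponential sum. Expanding `∑ χ(c) S(c) S(-c)` over pairs
gives `Q ε(χ) ∑ χ⁻¹(a - b)`. By the vanishing hypothesis and orthogonality it also equals `ε(χ) (Q³
- Q²)`. Hence the `Q² - Q` off-diagonal values, of norm at most 1, sum to `Q² - Q`, so each is 1
(`mulChar_sub_eq_one`).

With `m = (Q + 1) / d`, every `(a - b)^(Q-1)` is thus an `m`-th root of unity. For `u` in `μ_(Q+1)`
outside `μ_m`, the map `a ↦ a^Q - u a` is injective on `A` and fills the roots of `X^Q + u⁻¹ X`, so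
most elementary symmetric functions of the image vanish. As polynomials in `u` they have too many
zeros, and their leading coefficients give the vanishing of the upper coefficients of `∏ (X - a)`
(`coeff_prod_X_sub_C_eq_zero`). Applying this to the inverses of `A` kills the lower ones, leaving
`X^Q - X`. -/

theorem canonicalAddChar_isPrimitive (p : ℕ) [Fact p.Prime] (F : Type*) [Field F] [Finite F]
    [Algebra (ZMod p) F] : (canonicalAddChar p F).IsPrimitive := by
  refine AddChar.IsPrimitive.of_ne_one (AddChar.ne_one_iff.2 ?_)
  obtain ⟨x, hx⟩ := Algebra.trace_surjective (ZMod p) F 1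
  refine ⟨x, fun h => ?_⟩
  have h1 : ZMod.stdAddChar (N := p) (1 : ZMod p) = ZMod.stdAddChar (N := p) (0 : ZMod p) := by
    rw [AddChar.map_zero_eq_one, ← h, ← hx]
    rfl
  exact one_ne_zero (ZMod.injective_stdAddChar h1)

variable {F : Type*} [Field F] [Fintype F]

theorem MulChar.norm_apply_le_one (χ : MulChar F ℂ) (x : F) : ‖χ x‖ ≤ 1 := by
  by_cases hx : x = 0
  · rw [hx, χ.map_zero, norm_zero]
    exact zero_le_one
  · refine (Complex.norm_eq_one_of_pow_eq_one (n := Fintype.card F - 1) ?_ ?_).le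
    · rw [← map_pow, FiniteField.pow_card_sub_one_eq_one x hx, map_one]
    · exact (Nat.sub_pos_of_lt Fintype.one_lt_card).ne'

/-- If `x = g ^ t` with `g` a generator, then `χ x = 1` forces `χ ^ t = 1`, so the order of `χ`
divides `t`. -/
theorem MulChar.pow_eq_one_of_apply_eq_one {χ : MulChar F ℂ} {e : ℕ}
    (he : orderOf χ * e = Fintype.card F - 1) {x : F} (hx : χ x = 1) : x ^ e = 1 := by
  have hx0 : x ≠ 0 := by
    rintro rfl
    simp at hx
  obtain ⟨g, hg⟩ := IsCyclic.exists_generator (α := Fˣ)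
  obtain ⟨t, ht⟩ := mem_powers_iff_mem_zpowers.2 (hg (Units.mk0 x hx0))
  have hxt : x = (g : F) ^ t := by
    have h := congrArg Units.val ht
    simpa using h.symm
  have hpow : χ ^ t = 1 := by
    refine MulChar.ext fun y => ?_
    obtain ⟨s, rfl⟩ := mem_powers_iff_mem_zpowers.2 (hg y)
    rw [MulChar.pow_apply_coe, MulChar.one_apply_coe]
    simp only [Units.val_pow_eq_pow_val, map_pow]
    rw [← pow_mul, mul_comm, pow_mul, ← map_pow, ← hxt, hx, one_pow]
  obtain ⟨k, rfl⟩ := orderOf_dvd_of_pow_eq_one hpow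
  have hx' : x = ((g : F) ^ orderOf χ) ^ k := by rw [hxt, pow_mul]
  rw [hx', ← pow_mul, mul_comm k e, pow_mul, ← pow_mul (g : F), he,
    FiniteField.pow_card_sub_one_eq_one _ g.ne_zero, one_pow]

theorem sum_mulChar_mul_addChar {χ : MulChar F ℂ} (hχ : χ ≠ 1) (ψ : AddChar F ℂ) (x : F) :
    ∑ c, χ c * ψ (x * c) = χ⁻¹ x * gaussSum χ ψ := by
  by_cases hx : x = 0
  · subst hx
    simpa [MulChar.map_zero] using MulChar.sum_eq_zero_of_ne_one hχ
  · exact gaussSum_mulShift_eq χ ψ (Units.mk0 x hx)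

variable {p : ℕ} [Fact p.Prime] [Algebra (ZMod p) F]

/-- The factor at `-c` plays the role of the complex conjugate, so the product is `|S(c)|²` without
conjugation. -/
theorem sum_mul_expSum_mul_expSum_neg (f : F → ℂ) (A : Finset F) :
    ∑ c, f c * (expSum p A c * expSum p A (-c)) =
      ∑ a ∈ A, ∑ b ∈ A, ∑ c, f c * canonicalAddChar p F ((a - b) * c) := by
  simp_rw [expSum, Finset.sum_mul_sum, Finset.mul_sum]
  rw [Finset.sum_comm]
  refine Finset.sum_congr rfl fun a _ => ?_
  rw [Finset.sum_comm]
  refine Finset.sum_congr rfl fun b _ => Finset.sum_congr rfl fun c _ => ?_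
  rw [← AddChar.map_add_eq_mul]
  ring_nf

theorem sum_expSum_mul_expSum_neg (A : Finset F) :
    ∑ c, expSum p A c * expSum p A (-c) = Fintype.card F * A.card := by
  classical
  have h := sum_mul_expSum_mul_expSum_neg (p := p) (fun _ : F => 1) A
  simp only [one_mul] at h
  rw [h]
  have key : ∀ a ∈ A, ∑ b ∈ A, ∑ c, canonicalAddChar p F ((a - b) * c) =
      (Fintype.card F : ℂ) := by
    intro a ha
    simp_rw [mul_comm _ (_ : F), AddChar.sum_mulShift _ (canonicalAddChar_isPrimitive p F),
      sub_eq_zero]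
    simp [ha]
  rw [Finset.sum_congr rfl key]
  simp [mul_comm]

/-- If the exponential sums of a set of `Q` elements vanish away from `χ = ε(χ)`, then the
differences of distinct elements of the set lie in the kernel of `χ`. -/
theorem mulChar_sub_eq_one {χ : MulChar F ℂ} (hχ : χ ≠ 1) {A : Finset F} {Q : ℕ}
    (hQ : Fintype.card F = Q ^ 2) (hA : A.card = Q)
    (hS : ∀ c : F, c ≠ 0 → χ c ≠ normalizedGaussSum p χ → expSum p A c = 0) :
    ∀ a ∈ A, ∀ b ∈ A, a ≠ b → χ (a - b) = 1 := by
  classical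
  set ε := normalizedGaussSum p χ with hε
  set G := gaussSum χ (canonicalAddChar p F) with hG
  have hQ0 : (Q : ℂ) ≠ 0 := by
    have : Fintype.card F ≠ 0 := Fintype.card_ne_zero
    rw [hQ] at this
    exact_mod_cast (pow_ne_zero_iff two_ne_zero).1 this
  have hGε : G = Q * ε := by
    rw [hε, normalizedGaussSum, hQ, Nat.cast_pow, Real.sqrt_sq (Nat.cast_nonneg Q),
      Complex.ofReal_natCast, mul_inv_cancel_left₀ hQ0]
  have hG0 : G ≠ 0 := by
    refine gaussSum_ne_zero_of_nontrivial ?_ hχ (canonicalAddChar_isPrimitive p F)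
    exact_mod_cast Fintype.card_ne_zero
  have hε0 : ε ≠ 0 := by
    rintro h
    rw [hGε, h, mul_zero] at hG0
    exact hG0 rfl
  have hS0 : expSum p A 0 = (Q : ℂ) := by simp [expSum, hA]
  have hsum : ∑ a ∈ A, ∑ b ∈ A, χ⁻¹ (a - b) = (Q : ℂ) ^ 2 - Q := by
    have h1 := sum_mul_expSum_mul_expSum_neg (p := p) (fun c => χ c) A
    simp_rw [sum_mulChar_mul_addChar hχ, ← Finset.sum_mul] at h1
    -- On the support of `S`, `χ c` may be replaced by `ε`, except at `c = 0`, where `χ 0 = 0` while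
    -- `S(0)² = Q²`.
    have h2 : ∑ c, χ c * (expSum p A c * expSum p A (-c)) =
        ∑ c, (ε * (expSum p A c * expSum p A (-c)) - if c = 0 then ε * Q ^ 2 else 0) := by
      refine Finset.sum_congr rfl fun c _ => ?_
      by_cases hc : c = 0
      · subst hc
        rw [neg_zero, hS0, χ.map_zero, if_pos rfl]
        ring
      · rw [if_neg hc, sub_zero]
        by_cases h : χ c = ε
        · rw [h]
        · rw [hS c hc h]
          simp
    rw [h2, Finset.sum_sub_distrib, ← Finset.mul_sum, sum_expSum_mul_expSum_neg, hA, hQ,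
      Finset.sum_ite_eq' Finset.univ (0 : F), if_pos (Finset.mem_univ _), ← hG, hGε] at h1
    push_cast at h1
    refine mul_right_cancel₀ (mul_ne_zero hQ0 hε0) ?_
    rw [← h1]
    ring
  -- Equality case of the triangle inequality: the real parts, each at most 1, sum to the number of
  -- pairs.
  have hre : ∑ x ∈ A.offDiag, (1 - (χ⁻¹ (x.1 - x.2)).re) = 0 := by
    have h1 : ∑ x ∈ A.offDiag, χ⁻¹ (x.1 - x.2) = (Q : ℂ) ^ 2 - Q := by
      rw [← hsum, ← Finset.sum_product', ← Finset.diag_union_offDiag,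
        Finset.sum_union (Finset.disjoint_diag_offDiag A), Finset.sum_diag]
      simp [MulChar.map_zero]
    have h2 := congrArg Complex.re h1
    rw [Complex.re_sum] at h2
    rw [Finset.sum_sub_distrib, h2, Finset.sum_const, Finset.offDiag_card, hA, nsmul_eq_mul,
      mul_one, Nat.cast_sub (Nat.le_mul_self Q)]
    simp [sq]
  have hnonneg : ∀ x ∈ A.offDiag, 0 ≤ 1 - (χ⁻¹ (x.1 - x.2)).re := fun x _ =>
    sub_nonneg.2 ((Complex.re_le_norm _).trans (χ⁻¹.norm_apply_le_one _))
  intro a ha b hb hab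
  have h := (Finset.sum_eq_zero_iff_of_nonneg hnonneg).1 hre (a, b)
    (Finset.mem_offDiag.2 ⟨ha, hb, hab⟩)
  have hre1 : (χ⁻¹ (a - b)).re = 1 := (sub_eq_zero.1 h).symm
  have hle := χ⁻¹.norm_apply_le_one (a - b)
  have h1 : χ⁻¹ (a - b) = 1 := by
    have hsq : (χ⁻¹ (a - b)).re ^ 2 + (χ⁻¹ (a - b)).im ^ 2 ≤ 1 := by
      have h2 := Complex.sq_norm (χ⁻¹ (a - b))
      rw [Complex.normSq_apply] at h2
      nlinarith [norm_nonneg (χ⁻¹ (a - b))]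
    refine Complex.ext (by simpa using hre1) ?_
    rw [hre1] at hsq
    have : (χ⁻¹ (a - b)).im ^ 2 = 0 := le_antisymm (by linarith) (sq_nonneg _)
    simpa using this
  rw [MulChar.inv_apply_eq_inv, Ring.inverse_eq_inv', inv_eq_one] at h1
  exact h1

end CharacterSums

open Polynomial

/-! ### Directions and lacunary polynomials. -/

section Clique

variable {F : Type*} [Field F]

/-- If `a ↦ a ^ Q - u * a` is injective on a set of `Q` elements of the field with `Q ^ 2` elements
and `u ^ (Q + 1) = 1`, then its image is the set of roots of `X ^ Q + u⁻¹ X`. -/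
theorem prod_X_sub_C_pow_sub_mul [Fintype F] {p n : ℕ} [Fact p.Prime] [CharP F p]
    (hQ : 1 < p ^ n) (hF : Fintype.card F = (p ^ n) ^ 2) {A : Finset F} (hA : A.card = p ^ n)
    {u : F} (hu : u ^ (p ^ n + 1) = 1)
    (hinj : Set.InjOn (fun a : F => a ^ p ^ n - u * a) A) :
    ∏ a ∈ A, (X - C (a ^ p ^ n - u * a)) = X ^ p ^ n + C u⁻¹ * X := by
  classical
  have hu0 : u ≠ 0 := by
    rintro rfl
    simp at hu
  have huinv : u ^ p ^ n = u⁻¹ := by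
    rw [pow_succ] at hu
    exact eq_inv_of_mul_eq_one_left hu
  have hdeg : (C u⁻¹ * X : F[X]).degree < ((p ^ n : ℕ) : WithBot ℕ) := by
    refine (degree_C_mul_X_le _).trans_lt ?_
    exact_mod_cast hQ
  have hmon : (X ^ p ^ n + C u⁻¹ * X : F[X]).Monic := monic_X_pow_add hdeg
  have hnd : (X ^ p ^ n + C u⁻¹ * X : F[X]).natDegree = p ^ n := by
    rw [natDegree_add_eq_left_of_degree_lt]
    · simp
    · simpa using hdeg
  have hroots : A.val.map (fun a : F => a ^ p ^ n - u * a) =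
      (X ^ p ^ n + C u⁻¹ * X : F[X]).roots := by
    -- `Q` distinct roots of a polynomial of degree `Q` exhaust its roots.
    apply Multiset.eq_of_le_of_card_le
    · rw [Multiset.le_iff_subset]
      · intro z hz
        obtain ⟨a, -, rfl⟩ := Multiset.mem_map.1 hz
        rw [mem_roots hmon.ne_zero, IsRoot.def]
        have haq : (a ^ p ^ n) ^ p ^ n = a := by
          rw [← pow_mul, ← sq, ← hF, FiniteField.pow_card]
        simp only [eval_add, eval_pow, eval_X, eval_mul, eval_C]
        rw [sub_pow_char_pow, mul_pow, haq, huinv]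
        field_simp
        ring
      · exact Multiset.Nodup.map_on (fun x hx y hy h => hinj hx hy h) A.nodup
    · rw [Multiset.card_map, ← Finset.card_def, hA]
      exact (card_roots' _).trans hnd.le
  have hcard : Multiset.card (X ^ p ^ n + C u⁻¹ * X : F[X]).roots =
      (X ^ p ^ n + C u⁻¹ * X : F[X]).natDegree := by
    rw [← hroots, Multiset.card_map, ← Finset.card_def, hA, hnd]
  rw [← prod_multiset_X_sub_C_of_monic_of_roots_card_eq hmon hcard, ← hroots, Multiset.map_map]
  rfl

theorem prod_X_sub_C_coeff_eq_sum (A : Finset F) (f : F → F) {j : ℕ} (hj : j ≤ A.card) :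
    (∏ a ∈ A, (X - C (f a))).coeff (A.card - j) =
      ∑ t ∈ A.powersetCard j, ∏ a ∈ t, -f a := by
  have h := Finset.prod_X_add_C_coeff A (fun a => -f a) (Nat.sub_le A.card j)
  rw [Nat.sub_sub_self hj] at h
  rw [← h]
  simp [sub_eq_add_neg]

theorem card_pow_eq_one_and_pow_ne_one [Fintype F] [DecidableEq F] {k m : ℕ} (hm : 0 < m)
    (hk : k ∣ Fintype.card F - 1) :
    k - m ≤ (Finset.univ.filter fun u : F => u ^ k = 1 ∧ u ^ m ≠ 1).card := by
  obtain ⟨g, hg⟩ := IsCyclic.exists_ofOrder_eq_natCard (α := Fˣ)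
  rw [Nat.card_eq_fintype_card, Fintype.card_units] at hg
  have hpos : 0 < Fintype.card F - 1 := Nat.sub_pos_of_lt Fintype.one_lt_card
  obtain ⟨e, he⟩ := hk
  have hprim : IsPrimitiveRoot ((g : F) ^ e) k := by
    have h := IsPrimitiveRoot.orderOf g
    rw [hg] at h
    exact (IsPrimitiveRoot.coe_units_iff.2 h).pow hpos (by rw [he, mul_comm])
  have hk0 : 0 < k := Nat.pos_of_ne_zero (by rintro rfl; simp at he; omega)
  have h1 := hprim.card_nthRootsFinset
  have h2 : (nthRootsFinset m (1 : F)).card ≤ m := by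
    rw [nthRootsFinset]
    exact (@Multiset.toFinset_card_le _ (Classical.decEq F) _).trans (card_nthRoots m 1)
  have h3 := Finset.le_card_sdiff (nthRootsFinset m (1 : F)) (nthRootsFinset k (1 : F))
  have h4 : nthRootsFinset k (1 : F) \ nthRootsFinset m (1 : F) ⊆
      Finset.univ.filter fun u : F => u ^ k = 1 ∧ u ^ m ≠ 1 := by
    intro u hu
    rw [Finset.mem_sdiff, mem_nthRootsFinset hk0, mem_nthRootsFinset hm] at hu
    simpa using hu
  have h5 := Finset.card_le_card h4
  omega

/-- A set of `Q` elements of the field with `Q ^ 2` elements whose directions are all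
`m`-th roots of unity has a lacunary locator polynomial. -/
theorem coeff_prod_X_sub_C_eq_zero [Fintype F] {p n m : ℕ} [Fact p.Prime] [CharP F p]
    (hF : Fintype.card F = (p ^ n) ^ 2) {A : Finset F} (hA : A.card = p ^ n) (hm : 0 < m)
    (hdir : ∀ a ∈ A, ∀ b ∈ A, a ≠ b → ((a - b) ^ (p ^ n - 1)) ^ m = 1)
    {i : ℕ} (hi2 : 2 ≤ i) (him : m ≤ i) (hiQ : i < p ^ n) :
    (∏ a ∈ A, (X - C a)).coeff i = 0 := by
  classical
  obtain ⟨j, hj⟩ : ∃ j, j = p ^ n - i := ⟨_, rfl⟩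
  have hi : i = A.card - j := by omega
  have hjA : j ≤ A.card := by omega
  rw [hi, prod_X_sub_C_coeff_eq_sum A (fun a => a) hjA]
  -- At `u`, `P` is the `j`-th elementary symmetric function of the `u a - a^Q`; its coefficient at
  -- `j` is that of `A` itself.
  set P : F[X] := ∑ t ∈ A.powersetCard j, ∏ a ∈ t, (C a * X - C (a ^ p ^ n)) with hP
  have hlin : ∀ a : F, (C a * X - C (a ^ p ^ n)).natDegree ≤ 1 := fun a => by
    rw [sub_eq_add_neg, ← C_neg]
    exact natDegree_linear_le
  have hPdeg : P.natDegree ≤ j := by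
    refine natDegree_sum_le_of_forall_le _ _ fun t ht => ?_
    refine (natDegree_prod_le _ _).trans ?_
    refine (Finset.sum_le_card_nsmul _ _ 1 fun a _ => hlin a).trans ?_
    simp [(Finset.mem_powersetCard.1 ht).2]
  have hPcoeff : P.coeff j = ∑ t ∈ A.powersetCard j, ∏ a ∈ t, a := by
    rw [hP, finsetSum_coeff]
    refine Finset.sum_congr rfl fun t ht => ?_
    have h := coeff_prod_of_natDegree_le (s := t) (fun a : F => C a * X - C (a ^ p ^ n)) 1
      (fun a _ => hlin a)
    rw [mul_one, (Finset.mem_powersetCard.1 ht).2] at h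
    rw [h]
    refine Finset.prod_congr rfl fun a _ => ?_
    rw [coeff_sub, coeff_C_mul_X, coeff_C]
    simp
  have hP0 : P = 0 := by
    refine eq_zero_of_natDegree_lt_card_of_eval_eq_zero' P
      (Finset.univ.filter fun u : F => u ^ (p ^ n + 1) = 1 ∧ u ^ m ≠ 1) ?_ ?_
    · intro u hu
      obtain ⟨hu1, hum⟩ := (Finset.mem_filter.1 hu).2
      have hinj : Set.InjOn (fun a : F => a ^ p ^ n - u * a) A := by
        intro a ha b hb hab
        by_contra hne
        refine hum ?_
        rw [← hdir a ha b hb hne]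
        congr 1
        have hab0 : a - b ≠ 0 := sub_ne_zero.2 hne
        have hab' : (a - b) ^ p ^ n = u * (a - b) := by
          rw [sub_pow_char_pow]
          have : a ^ p ^ n - u * a = b ^ p ^ n - u * b := hab
          linear_combination this
        have hQ : p ^ n = p ^ n - 1 + 1 := by omega
        rw [hQ, pow_succ] at hab'
        exact (mul_right_cancel₀ hab0 hab').symm
      have h := prod_X_sub_C_coeff_eq_sum A (fun a => a ^ p ^ n - u * a) hjA
      rw [prod_X_sub_C_pow_sub_mul (by omega) hF hA hu1 hinj, ← hi, coeff_add, coeff_X_pow,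
        if_neg (by omega), coeff_C_mul, coeff_X, if_neg (by omega), mul_zero, add_zero] at h
      rw [hP, eval_finsetSum, h]
      refine Finset.sum_congr rfl fun t _ => ?_
      rw [eval_prod]
      refine Finset.prod_congr rfl fun a _ => ?_
      simp only [eval_sub, eval_mul, eval_C, eval_X]
      ring
    -- At least `Q + 1 - m` values of `u` are available, which exceeds `j = Q - i` exactly because
    -- `m ≤ i`.
    · refine lt_of_le_of_lt hPdeg (lt_of_lt_of_le ?_ (card_pow_eq_one_and_pow_ne_one hm ?_))
      · omega
      · rw [hF]
        exact ⟨p ^ n - 1, by rw [← Nat.sq_sub_sq, one_pow]⟩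
  have hsum : ∑ t ∈ A.powersetCard j, ∏ a ∈ t, -a =
      (-1) ^ j * ∑ t ∈ A.powersetCard j, ∏ a ∈ t, a := by
    rw [Finset.mul_sum]
    refine Finset.sum_congr rfl fun t ht => ?_
    rw [Finset.prod_neg, (Finset.mem_powersetCard.1 ht).2]
  rw [hsum, ← hPcoeff, hP0, coeff_zero, mul_zero]

theorem reverse_prod_X_sub_C {B : Finset F} (hB : (0 : F) ∉ B) :
    (∏ a ∈ B, (X - C a)).reverse = C (∏ a ∈ B, -a) * ∏ a ∈ B, (X - C a⁻¹) := by
  classical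
  induction B using Finset.induction_on with
  | empty => simpa using reverse_C (1 : F)
  | insert a s ha ih =>
    rw [Finset.mem_insert, not_or] at hB
    rw [Finset.prod_insert ha, Finset.prod_insert ha, Finset.prod_insert ha,
      reverse_mul_of_domain, ih hB.2]
    have h : (X - C a : F[X]).reverse = C (-a) * (X - C a⁻¹) := by
      have h1 : (X - C a : F[X]).reverse = 1 + C (-a) * X := by
        rw [sub_eq_add_neg, ← C_neg]
        have hX : (X : F[X]).reverse = 1 := by
          rw [← mul_one (X : F[X]), reverse_X_mul, ← C_1, reverse_C]
        rw [reverse_add_C, hX, natDegree_X, pow_one]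
      rw [h1, mul_sub, ← C_mul, neg_mul, mul_inv_cancel₀ (Ne.symm hB.1), C_neg, C_neg, C_1]
      ring
    rw [h, C_mul]
    ring

/-- Inverting the nonzero elements of a set reverses the coefficients of its locator polynomial. -/
theorem coeff_prod_X_sub_C_eq_zero_of_inv {A : Finset F} (h0 : (0 : F) ∈ A)
    {i j : ℕ} (hi : 1 ≤ i) (hj : 1 ≤ j) (hij : i + j = A.card + 1)
    (h : (∏ a ∈ A, (X - C a⁻¹)).coeff j = 0) :
    (∏ a ∈ A, (X - C a)).coeff i = 0 := by
  classical
  have hB : (0 : F) ∉ A.erase 0 := Finset.notMem_erase 0 A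
  have hcard : (A.erase 0).card = A.card - 1 := Finset.card_erase_of_mem h0
  obtain ⟨i, rfl⟩ := Nat.exists_eq_add_of_le' hi
  obtain ⟨j, rfl⟩ := Nat.exists_eq_add_of_le' hj
  -- Since `0⁻¹ = 0`, both products have a factor `X`. Removing it lowers both indices by one, so
  -- they sum to the degree `|A| - 1` of the reversed cofactor.
  rw [← Finset.mul_prod_erase A _ h0, inv_zero, C_0, sub_zero, coeff_X_mul] at h
  rw [← Finset.mul_prod_erase A _ h0, C_0, sub_zero, coeff_X_mul]
  have hrev := congrArg (fun P => P.coeff j) (reverse_prod_X_sub_C hB)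
  simp only [coeff_reverse, coeff_C_mul, h, mul_zero] at hrev
  rw [natDegree_finsetProd_X_sub_C_eq_card, hcard, revAt_le (by omega)] at hrev
  rwa [show A.card - 1 - j = i by omega] at hrev

/-- **Blokhuis–Sziklai**: a set of `Q` elements of the field with `Q ^ 2` elements that contains
`0` and `1` and has all its directions in a small group of roots of unity is the subfield with
`Q` elements. -/
theorem prod_X_sub_C_eq_of_directions [Fintype F] {p n m : ℕ} [Fact p.Prime] [CharP F p]
    (hF : Fintype.card F = (p ^ n) ^ 2) {A : Finset F} (hA : A.card = p ^ n) (hm : 0 < m)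
    (hm2 : 2 * m ≤ p ^ n + 1) (h0 : (0 : F) ∈ A) (h1 : (1 : F) ∈ A)
    (hdir : ∀ a ∈ A, ∀ b ∈ A, a ≠ b → ((a - b) ^ (p ^ n - 1)) ^ m = 1) :
    ∏ a ∈ A, (X - C a) = X ^ p ^ n - X := by
  classical
  have hQ : 1 < p ^ n := hA ▸ Finset.one_lt_card.2 ⟨0, h0, 1, h1, zero_ne_one⟩
  have hdir0 : ∀ b ∈ A, b ≠ 0 → (b ^ (p ^ n - 1)) ^ m = 1 := fun b hb hb0 => by
    simpa using hdir b hb 0 h0 hb0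
  have hdir' : ∀ a ∈ A.image (·⁻¹), ∀ b ∈ A.image (·⁻¹), a ≠ b →
      ((a - b) ^ (p ^ n - 1)) ^ m = 1 := by
    intro a' ha' b' hb' hab
    obtain ⟨a, ha, rfl⟩ := Finset.mem_image.1 ha'
    obtain ⟨b, hb, rfl⟩ := Finset.mem_image.1 hb'
    have hne : a ≠ b := fun h => hab (by rw [h])
    by_cases ha0 : a = 0
    · subst ha0
      have h := hdir 0 h0 b hb hne
      rw [zero_sub] at h
      rw [inv_zero, zero_sub, ← inv_neg, inv_pow, inv_pow, h, inv_one]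
    by_cases hb0 : b = 0
    · subst hb0
      rw [inv_zero, sub_zero, inv_pow, inv_pow, hdir0 a ha ha0, inv_one]
    -- `a⁻¹ - b⁻¹ = (b - a) / (a b)`, and `a`, `b` are themselves differences with `0 ∈ A`.
    rw [inv_sub_inv ha0 hb0, div_pow, div_pow, mul_pow, mul_pow, hdir0 a ha ha0,
      hdir0 b hb hb0, hdir b hb a ha (Ne.symm hne), one_mul, div_one]
  have hA' : (A.image (·⁻¹)).card = p ^ n := by
    rw [Finset.card_image_of_injective _ inv_injective, hA]
  have hcoeff : ∀ i, 2 ≤ i → i < p ^ n → (∏ a ∈ A, (X - C a)).coeff i = 0 := by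
    intro i hi2 hiQ
    by_cases him : m ≤ i
    · exact coeff_prod_X_sub_C_eq_zero hF hA hm hdir hi2 him hiQ
    -- For `i < m` the mirrored index `Q + 1 - i` is at least `m`, since `2 m ≤ Q + 1`.
    · refine coeff_prod_X_sub_C_eq_zero_of_inv h0 (j := p ^ n + 1 - i) (by omega) (by omega)
        (by omega) ?_
      have h := coeff_prod_X_sub_C_eq_zero hF hA' hm hdir' (i := p ^ n + 1 - i) (by omega)
        (by omega) (by omega)
      rwa [Finset.prod_image inv_injective.injOn] at h
  have hmon : (∏ a ∈ A, (X - C a)).Monic := monic_prod_of_monic _ _ fun a _ => monic_X_sub_C a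
  have hnd : (∏ a ∈ A, (X - C a)).natDegree = p ^ n := by
    rw [natDegree_finsetProd_X_sub_C_eq_card, hA]
  have hroot : ∀ b ∈ A, (∏ a ∈ A, (X - C a)).eval b = 0 := fun b hb => by
    rw [eval_prod]
    exact Finset.prod_eq_zero hb (by simp)
  have hform : ∏ a ∈ A, (X - C a) = X ^ p ^ n + C ((∏ a ∈ A, (X - C a)).coeff 1) * X := by
    ext i
    rw [coeff_add, coeff_X_pow, coeff_C_mul, coeff_X]
    rcases Nat.lt_or_ge (p ^ n) i with hi | hi
    · rw [coeff_eq_zero_of_natDegree_lt (by omega), if_neg (by omega), if_neg (by omega)]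
      simp
    rcases hi.eq_or_lt with rfl | hi
    · rw [if_pos rfl, if_neg (by omega), mul_zero, add_zero]
      conv_lhs => rw [← hnd]
      exact hmon
    rw [if_neg hi.ne]
    rcases Nat.lt_or_ge i 2 with hi2 | hi2
    · interval_cases i
      · simpa [coeff_zero_eq_eval_zero] using hroot 0 h0
      · simp
    · rw [hcoeff i hi2 hi, if_neg (by omega)]
      simp
  have hc : (∏ a ∈ A, (X - C a)).coeff 1 = -1 := by
    have h := hroot 1 h1
    rw [hform] at h
    simp only [eval_add, eval_pow, eval_X, one_pow, eval_mul, eval_C, mul_one] at h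
    exact (neg_eq_of_add_eq_zero_right h).symm
  rw [hform, hc, C_neg, C_1]
  ring

theorem exists_subfield_of_directions [Fintype F] {p n m : ℕ} [Fact p.Prime] [CharP F p]
    (hF : Fintype.card F = (p ^ n) ^ 2) {A : Finset F} (hA : A.card = p ^ n) (hm : 0 < m)
    (hm2 : 2 * m ≤ p ^ n + 1) (h0 : (0 : F) ∈ A) (h1 : (1 : F) ∈ A)
    (hdir : ∀ a ∈ A, ∀ b ∈ A, a ≠ b → ((a - b) ^ (p ^ n - 1)) ^ m = 1) :
    ∃ K : Subfield F, Nat.card K = p ^ n ∧ (A : Set F) = (K : Set F) := by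
  have hprod := prod_X_sub_C_eq_of_directions hF hA hm hm2 h0 h1 hdir
  have hAK : (A : Set F) =
      ((iterateFrobenius F p n).eqLocusField (RingHom.id F) : Subfield F) := by
    ext x
    rw [SetLike.mem_coe, SetLike.mem_coe, RingHom.mem_eqLocusField, iterateFrobenius_def,
      RingHom.id_apply, ← sub_eq_zero]
    have h := congrArg (eval x) hprod
    rw [eval_prod] at h
    simp only [eval_sub, eval_X, eval_C, eval_pow] at h
    rw [← h, Finset.prod_eq_zero_iff]
    simp [sub_eq_zero]
  refine ⟨_, ?_, hAK⟩
  exact (Nat.card_congr (Equiv.setCongr hAK)).symm.trans (by simp [hA])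

end Clique

/-! ### Combination of the two halves. -/

theorem proposition3p2 (p n d : ℕ) [Fact p.Prime] (hp : p ≠ 2)
    (F : Type*) [Field F] [Fintype F] [Algebra (ZMod p) F]
    (hq : Fintype.card F = p ^ (2 * n))
    (hd : 1 < d) (hdvd : d ∣ p ^ n + 1)
    (χ : MulChar F ℂ) (hχ : orderOf χ = d)
    (A : Finset F) (h0 : (0 : F) ∈ A) (h1 : (1 : F) ∈ A) (hA : A.card = p ^ n)
    (hS : ∀ c : F, c ≠ 0 → χ c ≠ normalizedGaussSum p χ → expSum p A c = 0) :
    ∃ K : Subfield F, Nat.card K = p ^ n ∧ (A : Set F) = (K : Set F) := by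
  have : CharP F p := charP_of_injective_algebraMap (algebraMap (ZMod p) F).injective p
  have hF : Fintype.card F = (p ^ n) ^ 2 := by rw [hq, mul_comm, pow_mul]
  have hχ1 : χ ≠ 1 := by
    rintro rfl
    rw [orderOf_one] at hχ
    omega
  obtain ⟨m, hm⟩ := hdvd
  have hm0 : 0 < m := Nat.pos_of_ne_zero (by rintro rfl; simp at hm)
  refine exists_subfield_of_directions hF hA hm0 ?_ h0 h1 fun a ha b hb hab => ?_
  · rw [hm]
    exact Nat.mul_le_mul_right m hd
  · rw [← pow_mul]
    refine MulChar.pow_eq_one_of_apply_eq_one ?_ (mulChar_sub_eq_one hχ1 hF hA hS a ha b hb hab)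
    -- `q - 1 = (Q + 1) (Q - 1) = d m (Q - 1)`, so the kernel of `χ` consists of `(Q - 1) m`-th
    -- roots of unity.
    rw [hχ, hF, mul_left_comm, ← hm, mul_comm, ← Nat.sq_sub_sq, one_pow]
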